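/- Let $R$ be an excellent Noetherian ring (commutative with $1$) and let $I$ be an ideal of $R$. Then the inner integral closure of $I$ is contained in the axes closure of $I$: $$I_{>1}\subseteq I^{\mathrm{ax}}.$$ Here the inner integral closure $I_{>1}$ is the set of all $r\in R$ that satisfy an equation $r^d+a_1r^{d-1}+\dots+a_d=0$ for some $d\ge 1$, with $a_j\in I\cdot I^{j}=I^{j+1}$ for $1\le j\le d$. The axes closure $I^{\mathrm{ax}}$ is the set of all $f\in R$ that satisfy the following three conditions (which are equivalent for Noetherian $R$): for every ring homomorphism $\varphi\colon R\to S$, where $S$ is a one-dimensional seminormal Noetherian ring that is (1) excellent, (2) excellent and local, or (3) local and complete in the topology of its maximal ideal, one has $\varphi(f)\in IS$. A ring $S$ is seminormal if it is reduced and every element $x$ of its total quotient ring with $x^2,x^3\in S$ lies in $S$. -/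

import Mathlib

open scoped TensorProduct nonZeroDivisors

universe u v

/-! ### Excellent rings -/

/-- A ring is catenary if for all primes `p`, `q` the lengths of the finite chains of primes
from `p` to `q` are bounded, and any two saturated chains of primes from `p` to `q` have the
same length. -/
def IsCatenaryRing (R : Type u) [CommRing R] : Prop :=
  (∀ p q : PrimeSpectrum R, ∃ N : ℕ, ∀ c : LTSeries (PrimeSpectrum R),
      c.head = p → c.last = q → c.length ≤ N) ∧
  ∀ c c' : RelSeries {(p, q) : PrimeSpectrum R × PrimeSpectrum R | p ⋖ q},
      c.head = c'.head → c.last = c'.last → c.length = c'.length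

/-- `R` is universally catenary if every finitely generated `R`-algebra is catenary
(used for Noetherian `R` only). -/
def IsUniversallyCatenaryRing (R : Type u) [CommRing R] : Prop :=
  ∀ (A : Type u) [CommRing A] [Algebra R A] [Algebra.FiniteType R A], IsCatenaryRing A

/-- An algebra `A` over a field `k` is geometrically regular if `L ⊗ A` is a (Noetherian)
regular ring for every finite field extension `L` of `k`. -/
def IsGeometricallyRegular (k : Type u) [Field k] (A : Type u) [CommRing A] [Algebra k A] : Prop :=
  ∀ (L : Type u) [Field L] [Algebra k L] [Module.Finite k L], IsRegularRing (L ⊗[k] A)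

/-- The completion of a local ring at its maximal ideal. -/
abbrev LocalCompletion (A : Type u) [CommRing A] [IsLocalRing A] : Type u :=
  AdicCompletion (IsLocalRing.maximalIdeal A) A

/-- `R` is a G-ring if, for each prime `p`, all the fibres of the map from `R_p` to its completion
(the formal fibres of `R_p`) are geometrically regular. -/
def IsGRing (R : Type u) [CommRing R] : Prop :=
  ∀ (p : Ideal R) [p.IsPrime] (q : Ideal (Localization.AtPrime p)) [q.IsPrime],
    IsGeometricallyRegular q.ResidueField (q.Fiber (LocalCompletion (Localization.AtPrime p)))

/-- The regular locus of `Spec A`. -/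
def regularLocus (A : Type u) [CommRing A] : Set (PrimeSpectrum A) :=
  {p | IsRegularLocalRing (Localization.AtPrime p.asIdeal)}

/-- `R` is J-2 if every finitely generated `R`-algebra has open regular locus. -/
def IsJTwoRing (R : Type u) [CommRing R] : Prop :=
  ∀ (A : Type u) [CommRing A] [Algebra R A] [Algebra.FiniteType R A], IsOpen (regularLocus A)

/-- Excellent (Noetherian) rings. -/
structure IsExcellentRing (R : Type u) [CommRing R] : Prop where
  isNoetherianRing : IsNoetherianRing R
  isUniversallyCatenaryRing : IsUniversallyCatenaryRing R
  isGRing : IsGRing R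
  isJTwoRing : IsJTwoRing R

/-! ### Seminormal rings and axes closure -/

/-- A ring is seminormal if it is reduced and every element `x` of its total quotient ring with
`x ^ 2` and `x ^ 3` in the ring lies in the ring. -/
def IsSeminormalRing (S : Type v) [CommRing S] : Prop :=
  IsReduced S ∧ ∀ x : Localization S⁰,
    x ^ 2 ∈ (algebraMap S (Localization S⁰)).range →
    x ^ 3 ∈ (algebraMap S (Localization S⁰)).range →
    x ∈ (algebraMap S (Localization S⁰)).range

/-- Excellent one-dimensional seminormal rings. -/
def IsExcellentOneDimSeminormal (S : Type v) [CommRing S] : Prop :=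
  IsExcellentRing S ∧ ringKrullDim S = 1 ∧ IsSeminormalRing S

/-- Excellent local one-dimensional seminormal rings. -/
def IsExcellentLocalOneDimSeminormal (S : Type v) [CommRing S] : Prop :=
  IsLocalRing S ∧ IsExcellentOneDimSeminormal S

/-- Complete (Noetherian) local one-dimensional seminormal rings. -/
def IsCompleteLocalOneDimSeminormal (S : Type v) [CommRing S] : Prop :=
  IsNoetherianRing S ∧
  (∃ _ : IsLocalRing S, IsAdicComplete (IsLocalRing.maximalIdeal S) S) ∧
  ringKrullDim S = 1 ∧ IsSeminormalRing S

/-- For a class `P` of rings, the ideal of all `f : R` such that for every ring homomorphism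
`φ : R → S` to a ring of the class, `φ f` lies in the extended ideal `I S`. -/
def closureVia (P : ∀ (S : Type v) [CommRing S], Prop) {R : Type u} [CommRing R] (I : Ideal R) :
    Ideal R :=
  ⨅ (S : Type v) (_ : CommRing S) (_ : P S) (φ : R →+* S), (I.map φ).comap φ

/-- The axes closure of `I`: all `f : R` whose image is in `I S` for every homomorphism from `R`
to a ring `S` that is one-dimensional seminormal and excellent, respectively excellent local,
respectively complete local. (The three conditions are equivalent when `R` is Noetherian.) -/
def axesClosure {R : Type u} [CommRing R] (I : Ideal R) : Ideal R :=
  closureVia.{u, v} (fun S _ => IsExcellentOneDimSeminormal S) I ⊓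
  closureVia.{u, v} (fun S _ => IsExcellentLocalOneDimSeminormal S) I ⊓
  closureVia.{u, v} (fun S _ => IsCompleteLocalOneDimSeminormal S) I

theorem mem_closureVia (P : ∀ (S : Type v) [CommRing S], Prop) {R : Type u} [CommRing R]
    (I : Ideal R) (f : R) :
    f ∈ closureVia.{u, v} P I ↔
      ∀ (S : Type v) [CommRing S], P S → ∀ φ : R →+* S, φ f ∈ I.map φ := by
  simp only [closureVia, Submodule.mem_iInf, Ideal.mem_comap]

/-! ### Special and inner integral closure -/

/-- The `J`-special integral closure of `I`: all `r` that are a root of a monic polynomial of some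
degree `d ≥ 1` whose coefficient of `x ^ (d - j)` is in `J * I ^ j` for `1 ≤ j ≤ d`. -/
def specialIntegralClosure {R : Type u} [CommRing R] (J I : Ideal R) : Set R :=
  {r | ∃ d : ℕ, 1 ≤ d ∧ ∃ a : ℕ → R, (∀ j ∈ Finset.Icc 1 d, a j ∈ J * I ^ j) ∧
    r ^ d + ∑ j ∈ Finset.Icc 1 d, a j * r ^ (d - j) = 0}

/-- The inner integral closure of `I`, i.e. its `I`-special integral closure. -/
def innerIntegralClosure {R : Type u} [CommRing R] (I : Ideal R) : Set R :=
  specialIntegralClosure I I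

/-! The inner closure persists under homomorphisms, so it suffices that `J_{>1} ⊆ J` for every ideal
`J = (x_1, …, x_n)` of a one-dimensional seminormal Noetherian ring `S`. Let `S'` be the integral
closure of `S` in its total quotient ring `Q`, a finite product of fields. On the components where
it does not vanish, `J S'` is invertible: there are `z_j` in `Q` with `z_j J ⊆ S'` such that `∑ x_j
z_j` acts as the identity on `J`. Multiplying the equation of `f` by `z_j ^ d` gives a monic
equation for `y_j = z_j f` with lower coefficients in `z_j ^ i J ^ (i + 1) ⊆ J S'`, so `y_j` lies in
the radical of `J S'`. Conductors of seminormal rings are radical, so `y_j` lies in `S` locally at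
any maximal ideal containing `J`, and `f = ∑ x_j y_j` lies in `J` there.

Invertibility rests on a length count: powers of `(a, b)` need boundedly many generators, so `a / b`
satisfies a polynomial with a coefficient outside a given prime. -/

/-! ### Lengths and relations in one-dimensional domains -/

open scoped Pointwise in
/-- For a nonzero ideal `M` of a one-dimensional Noetherian domain, `M / tM` has the same length
as `A / tA`; only this inequality is needed. -/
theorem length_quotient_smul_top_le {A : Type*} [CommRing A] [IsDomain A] [IsNoetherianRing A]
    [Ring.KrullDimLE 1 A] {t : A} (ht : t ≠ 0) {M : Ideal A} (hM : M ≠ ⊥) :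
    Module.length A (M ⧸ (t • ⊤ : Submodule A M)) ≤ Ring.ord A t := by
  -- The length of `A / tM` is computed along `tM ⊆ tA ⊆ A`, where `tA / tM ≅ A / M`, and along `tM
  -- ⊆ M ⊆ A`; the finite length of `A / M` then cancels.
  have h1 := Module.length_eq_add_of_exact (Ideal.mulQuot t M) (Ideal.quotOfMul t M)
    (Ideal.mulQuot_injective M (mem_nonZeroDivisors_of_ne_zero ht))
    (Ideal.quotOfMul_surjective M) (Ideal.exact_mulQuot_quotOfMul M)
  have hmap : (t • ⊤ : Submodule A M).map M.subtype = t • M := by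
    rw [Submodule.map_pointwise_smul, Submodule.map_subtype_top]
  have hle : (t • ⊤ : Submodule A M) ≤ Submodule.comap M.subtype (t • M) := by
    rw [← Submodule.map_le_iff_le_comap, hmap]
  have h2 := Module.length_eq_add_of_exact
    (Submodule.mapQ (t • ⊤ : Submodule A M) (t • M) M.subtype hle)
    (Submodule.factor (Submodule.smul_le_self_of_tower t M))
    (by
      rw [← LinearMap.ker_eq_bot, Submodule.mapQ]
      refine Submodule.ker_liftQ_eq_bot' _ _ ?_
      rw [LinearMap.ker_comp, Submodule.ker_mkQ, ← hmap,
        Submodule.comap_map_eq_of_injective M.subtype_injective])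
    (Submodule.factor_surjective _)
    (by
      rw [LinearMap.exact_iff, Submodule.factor, Submodule.mapQ, Submodule.mapQ,
        Submodule.ker_liftQ, Submodule.range_liftQ, LinearMap.range_comp, LinearMap.comp_id,
        Submodule.ker_mkQ, Submodule.range_subtype])
  have hfin : Module.length A (A ⧸ M) ≠ ⊤ := by
    obtain ⟨m, hmM, hm⟩ := Submodule.exists_mem_ne_zero_of_ne_bot hM
    refine ne_top_of_le_ne_top (Ring.ord_ne_top (mem_nonZeroDivisors_of_ne_zero hm)) ?_
    exact Module.length_le_of_surjective
      (Submodule.factor ((Ideal.span_singleton_le_iff_mem M).mpr hmM))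
      (Submodule.factor_surjective _)
  rw [h1, add_comm] at h2
  exact (WithTop.add_right_cancel hfin h2).ge

open scoped Pointwise in
/-- In a one-dimensional Noetherian domain the number of generators of a nonzero ideal, modulo a
prime, is bounded independently of the ideal; so the monomials of high degree in two elements are
linearly dependent with a coefficient outside the prime. -/
theorem exists_homogeneous_relation {A : Type*} [CommRing A] [IsDomain A] [IsNoetherianRing A]
    [Ring.KrullDimLE 1 A] (p : Ideal A) [p.IsPrime] {a b : A} (ha : a ≠ 0) (hb : b ≠ 0) :
    ∃ (n : ℕ) (c : Fin (n + 1) → A), (∃ i, c i ∉ p) ∧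
      ∑ i, c i * (a ^ (i : ℕ) * b ^ (n - i)) = 0 := by
  by_cases hp : p = ⊥
  · refine ⟨1, ![a, -b], ⟨0, by simpa [hp] using ha⟩, ?_⟩
    simp [Fin.sum_univ_two]; ring
  obtain ⟨t, htp, ht⟩ := Submodule.exists_mem_ne_zero_of_ne_bot hp
  -- With `n` the length of `A / tA`, the `n + 1` monomials of degree `n` are one too many.
  obtain ⟨n, hn⟩ := ENat.ne_top_iff_exists.mp
    (Ring.ord_ne_top (mem_nonZeroDivisors_of_ne_zero ht))
  by_contra! hcon
  have hc := hcon n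
  set m : Fin (n + 1) → A := fun i ↦ a ^ (i : ℕ) * b ^ (n - i) with hm
  let φ : (Fin (n + 1) → A) →ₗ[A] A := Fintype.linearCombination A m
  let M : Ideal A := LinearMap.range φ
  have hM : M ≠ ⊥ := by
    intro h
    have : m 0 ∈ M := ⟨Pi.single 0 1, by simp [φ, Fintype.linearCombination_apply_single]⟩
    rw [h, Ideal.mem_bot] at this
    exact mul_ne_zero (pow_ne_zero _ ha) (pow_ne_zero _ hb) this
  let π : (Fin (n + 1) → A) →ₗ[A] (Fin (n + 1) → A ⧸ p) :=
    LinearMap.pi fun i ↦ (Submodule.mkQ p) ∘ₗ LinearMap.proj i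
  have hπ : Function.Surjective π := by
    intro y
    choose g hg using fun i ↦ Submodule.mkQ_surjective p (y i)
    exact ⟨g, funext fun i ↦ hg i⟩
  have hker : LinearMap.ker φ.rangeRestrict ≤ LinearMap.ker π := by
    intro c hcz
    rw [LinearMap.ker_rangeRestrict, LinearMap.mem_ker] at hcz
    rw [LinearMap.mem_ker]
    funext i
    refine (Submodule.Quotient.mk_eq_zero p).mpr ?_
    by_contra hi
    refine hc c ⟨i, hi⟩ ?_
    simpa [φ, Fintype.linearCombination_apply] using hcz
  let e := φ.rangeRestrict.quotKerEquivOfSurjective φ.surjective_rangeRestrict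
  -- If all relations have coefficients in `p`, reducing coefficients mod `p` is well defined on
  -- `M`. Since `t ∈ p`, it maps `M / tM`, of length at most `n`, onto `(A / p) ^ (n + 1)`.
  let ψ : M →ₗ[A] (Fin (n + 1) → A ⧸ p) := (Submodule.liftQ _ π hker) ∘ₗ e.symm.toLinearMap
  have hψ : Function.Surjective ψ := by
    intro y
    obtain ⟨c, rfl⟩ := hπ y
    exact ⟨e (Submodule.Quotient.mk c), by simp [ψ]⟩
  have hψt : (t • ⊤ : Submodule A M) ≤ LinearMap.ker ψ := by
    intro x hx
    obtain ⟨y, -, rfl⟩ := Submodule.mem_smul_pointwise_iff_exists _ _ _ |>.mp hx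
    rw [LinearMap.mem_ker, map_smul]
    funext i
    obtain ⟨w, hw⟩ := Submodule.mkQ_surjective p (ψ y i)
    rw [Pi.smul_apply, ← hw, ← map_smul]
    exact (Submodule.Quotient.mk_eq_zero p).mpr (p.mul_mem_right w htp)
  have h1 : Module.length A (Fin (n + 1) → A ⧸ p) ≤ n := by
    rw [hn]
    refine le_trans ?_ (length_quotient_smul_top_le ht hM)
    exact Module.length_le_of_surjective (Submodule.liftQ _ ψ hψt) fun y ↦ by
      obtain ⟨c, rfl⟩ := hψ y
      exact ⟨Submodule.Quotient.mk c, rfl⟩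
  have h2 : 1 ≤ Module.length A (A ⧸ p) := by
    exact Order.one_le_iff_pos.mpr (Module.length_pos_iff.mpr inferInstance)
  rw [Module.length_pi] at h1
  have h3 : ((n + 1 : ℕ) : ℕ∞) ≤ n := by
    refine le_trans ?_ h1
    simpa using mul_le_mul_right h2 ((n + 1 : ℕ) : ℕ∞)
  exact absurd (Nat.cast_le.mp h3) (by simp)

/-! ### The Prüfer property of the integral closure -/

open Polynomial in
/-- If `z` is a root of a polynomial over an integrally closed ring `D` with some coefficient
outside the prime `P`, then `z` or `z⁻¹` is in the local ring at `P`. -/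
theorem exists_mul_mem_or_mul_inv_mem {S K : Type*} [CommRing S] [Field K] [Algebra S K]
    (P : Ideal (integralClosure S K)) [P.IsPrime] (z : K) :
    ∀ (n : ℕ) (q : (integralClosure S K)[X]), q.natDegree ≤ n → (∃ i, q.coeff i ∉ P) →
      aeval z q = 0 → ∃ u : integralClosure S K, u ∉ P ∧
        (IsIntegral S ((u : K) * z) ∨ IsIntegral S ((u : K) * z⁻¹)) := by
  intro n
  induction n with
  | zero =>
    rintro q hq ⟨i, hi⟩ h
    rw [eq_C_of_natDegree_le_zero hq] at h hi
    replace h : q.coeff 0 = 0 := by simpa [Subalgebra.algebraMap_def] using h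
    simp [h] at hi
  | succ n ih =>
    rintro q hq ⟨i, hi⟩ h
    set c := q.coeff (n + 1) with hcdef
    have hint : ∀ w : K, IsIntegral (integralClosure S K) w → IsIntegral S w :=
      fun w hw ↦ isIntegral_trans w hw
    have hcz : IsIntegral S ((c : K) * z) := by
      rcases hq.lt_or_eq with hlt | heq
      · rw [hcdef, coeff_eq_zero_of_natDegree_lt hlt]
        simpa using isIntegral_zero
      · have := isIntegral_leadingCoeff_smul q z h
        rw [leadingCoeff, heq] at this
        exact hint _ this
    by_cases hcP : c ∈ P
    swap
    · exact ⟨c, hcP, Or.inl hcz⟩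
    let d : integralClosure S K := ⟨c * z, hcz⟩
    by_cases hdP : d ∈ P
    swap
    · refine ⟨d, hdP, Or.inr ?_⟩
      by_cases hz : z = 0
      · simpa [hz] using isIntegral_zero
      · have : (d : K) * z⁻¹ = c := by simp [d, hz]
        rw [this]
        exact c.2
    -- As `d = c z`, trading `c X ^ (n + 1)` for `d X ^ n` preserves the value at `z`, lowers the
    -- degree bound, and changes coefficients only by elements of `P`.
    let q' := q - C c * X ^ (n + 1) + C d * X ^ n
    have hcoeff : ∀ j, q'.coeff j = q.coeff j - (if j = n + 1 then c else 0) +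
        (if j = n then d else 0) := fun j ↦ by
      simp only [q', coeff_add, coeff_sub, coeff_C_mul_X_pow]
    refine ih q' ?_ ⟨i, ?_⟩ ?_
    · rw [natDegree_le_iff_coeff_eq_zero]
      intro j hj
      rw [hcoeff, if_neg (show j ≠ n by omega)]
      by_cases hj' : j = n + 1
      · simp [hj', hcdef]
      · rw [if_neg hj', coeff_eq_zero_of_natDegree_lt (by omega)]
        simp
    · rw [hcoeff]
      intro hmem
      refine hi ?_
      have e1 : (if i = n + 1 then c else 0) ∈ P := by split_ifs <;> simp [hcP]
      have e2 : (if i = n then d else 0) ∈ P := by split_ifs <;> simp [hdP]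
      have := P.add_mem (P.sub_mem hmem e2) e1
      simpa using this
    · simp only [q', map_add, map_sub, h, map_mul, aeval_C, map_pow, aeval_X,
        Subalgebra.algebraMap_def, Algebra.algebraMap_self, RingHom.id_apply, d]
      ring

/-- The integral closure in a field of a one-dimensional Noetherian ring is Prüfer: of two
elements coming from the base ring, one divides the other locally at any prime. -/
theorem exists_mul_div_isIntegral_or {S K : Type*} [CommRing S] [IsNoetherianRing S]
    [Ring.KrullDimLE 1 S] [Field K] [Algebra S K] (P : Ideal (integralClosure S K)) [P.IsPrime]
    (a b : S) :
    ∃ u : integralClosure S K, u ∉ P ∧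
      (IsIntegral S ((u : K) * (algebraMap S K a / algebraMap S K b)) ∨
        IsIntegral S ((u : K) * (algebraMap S K b / algebraMap S K a))) := by
  by_cases ha : algebraMap S K a = 0
  · exact ⟨1, (Ideal.ne_top_iff_one P).mp (Ideal.IsPrime.ne_top ‹_›), Or.inl (by
      simpa [ha] using isIntegral_zero)⟩
  -- Here `a / b = 0` by the convention on division by zero.
  by_cases hb : algebraMap S K b = 0
  · exact ⟨1, (Ideal.ne_top_iff_one P).mp (Ideal.IsPrime.ne_top ‹_›), Or.inl (by
      simpa [hb] using isIntegral_zero)⟩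
  let N := RingHom.ker (algebraMap S K)
  have : N.IsPrime := RingHom.ker_isPrime _
  have hdim : Ring.KrullDimLE 1 (S ⧸ N) := by
    rw [Ring.KrullDimLE, Order.krullDimLE_iff]
    exact (ringKrullDim_quotient_le N).trans (Order.krullDimLE_iff _ _ |>.mp ‹Ring.KrullDimLE 1 S›)
  let g : S ⧸ N →+* integralClosure S K := Ideal.Quotient.lift N (algebraMap S _) fun s hs ↦
    Subtype.ext (by simpa using! hs)
  have hne : ∀ s : S, algebraMap S K s ≠ 0 → Ideal.Quotient.mk N s ≠ 0 := fun s hs h ↦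
    hs (Ideal.Quotient.eq_zero_iff_mem.mp h)
  obtain ⟨n, c, ⟨i, hi⟩, hc⟩ := exists_homogeneous_relation (P.comap g) (hne a ha) (hne b hb)
  choose r hr using fun i ↦ Ideal.Quotient.mk_surjective (c i)
  have hrel : ∑ i, algebraMap S K (r i) *
      (algebraMap S K a ^ (i : ℕ) * algebraMap S K b ^ (n - i)) = 0 := by
    have h0 : Ideal.Quotient.mk N (∑ i, r i * (a ^ (i : ℕ) * b ^ (n - i))) = 0 := by
      simpa [hr] using hc
    simpa using (show algebraMap S K _ = 0 from Ideal.Quotient.eq_zero_iff_mem.mp h0)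
  let q : Polynomial (integralClosure S K) :=
    ∑ i, Polynomial.C (algebraMap S (integralClosure S K) (r i)) * Polynomial.X ^ (i : ℕ)
  obtain ⟨u, hu, h⟩ : ∃ u : integralClosure S K, u ∉ P ∧
      (IsIntegral S ((u : K) * (algebraMap S K a / algebraMap S K b)) ∨
        IsIntegral S ((u : K) * (algebraMap S K a / algebraMap S K b)⁻¹)) := by
    refine exists_mul_mem_or_mul_inv_mem P _ q.natDegree q le_rfl ⟨i, ?_⟩ ?_
    · have : q.coeff i = g (c i) := by
        simp only [q, Polynomial.finsetSum_coeff, Polynomial.coeff_C_mul_X_pow, Fin.val_inj]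
        simp [← hr, g]
      rw [this]
      exact hi
    · have hz : ∀ i : Fin (n + 1), (algebraMap S K a / algebraMap S K b) ^ (i : ℕ) =
          (algebraMap S K b ^ n)⁻¹ *
            (algebraMap S K a ^ (i : ℕ) * algebraMap S K b ^ (n - i)) := fun i ↦ by
        have hbn : algebraMap S K b ^ n = algebraMap S K b ^ (i : ℕ) * algebraMap S K b ^ (n - i) := by
          rw [← pow_add, Nat.add_sub_of_le (Nat.le_of_lt_succ i.2)]
        rw [hbn, div_pow]
        field_simp
      calc Polynomial.aeval (algebraMap S K a / algebraMap S K b) q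
          = ∑ i : Fin (n + 1), algebraMap S K (r i) *
            (algebraMap S K a / algebraMap S K b) ^ (i : ℕ) := by
            simp only [q, map_sum, map_mul, Polynomial.aeval_C, map_pow, Polynomial.aeval_X]
            rfl
        _ = (algebraMap S K b ^ n)⁻¹ * ∑ i : Fin (n + 1), algebraMap S K (r i) *
            (algebraMap S K a ^ (i : ℕ) * algebraMap S K b ^ (n - i)) := by
            rw [Finset.mul_sum]
            exact Finset.sum_congr rfl fun i _ ↦ by rw [hz]; ring
        _ = 0 := by rw [hrel, mul_zero]
  exact ⟨u, hu, by rwa [inv_div] at h⟩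

/-- Locally at a prime of the integral closure, one of finitely many elements of the base ring
divides all of them. -/
theorem exists_forall_mul_div_isIntegral {S K : Type*} [CommRing S] [IsNoetherianRing S]
    [Ring.KrullDimLE 1 S] [Field K] [Algebra S K] (P : Ideal (integralClosure S K)) [P.IsPrime]
    {ι : Type*} [Fintype ι] (x : ι → S) (hx : ∃ j, algebraMap S K (x j) ≠ 0) :
    ∃ (u : integralClosure S K) (j : ι), u ∉ P ∧ algebraMap S K (x j) ≠ 0 ∧
      ∀ l, IsIntegral S ((u : K) * (algebraMap S K (x l) / algebraMap S K (x j))) := by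
  classical
  have h1 : (1 : integralClosure S K) ∉ P := (Ideal.ne_top_iff_one P).mp (Ideal.IsPrime.ne_top ‹_›)
  suffices H : ∀ s : Finset ι, ∃ (u : integralClosure S K) (j : ι), u ∉ P ∧
      algebraMap S K (x j) ≠ 0 ∧
      ∀ l ∈ s, IsIntegral S ((u : K) * (algebraMap S K (x l) / algebraMap S K (x j))) by
    obtain ⟨u, j, h⟩ := H Finset.univ
    exact ⟨u, j, h.1, h.2.1, fun l ↦ h.2.2 l (Finset.mem_univ l)⟩
  intro s
  induction s using Finset.induction_on with
  | empty =>
    obtain ⟨j, hj⟩ := hx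
    exact ⟨1, j, h1, hj, by simp⟩
  | insert k s hk ih =>
    obtain ⟨u, j, hu, hj, h⟩ := ih
    by_cases hk0 : algebraMap S K (x k) = 0
    · refine ⟨u, j, hu, hj, fun l hl ↦ ?_⟩
      rcases Finset.mem_insert.mp hl with rfl | hl
      · simpa [hk0] using isIntegral_zero
      · exact h l hl
    obtain ⟨w, hw, hw'⟩ := exists_mul_div_isIntegral_or P (x k) (x j)
    have huw : u * w ∉ P := fun hmem ↦ (Ideal.IsPrime.mem_or_mem ‹_› hmem).elim hu hw
    rcases hw' with hw' | hw'
    · refine ⟨u * w, j, huw, hj, fun l hl ↦ ?_⟩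
      rcases Finset.mem_insert.mp hl with rfl | hl
      · have := u.2.mul hw'
        rwa [← mul_assoc] at this
      · have := w.2.mul (h l hl)
        rwa [← mul_assoc, mul_comm (w : K)] at this
    · refine ⟨u * w, k, huw, hk0, fun l hl ↦ ?_⟩
      rcases Finset.mem_insert.mp hl with rfl | hl
      · rw [div_self hk0, mul_one]
        exact (u * w).2
      · have := (h l hl).mul hw'
        have e : ((u * w : integralClosure S K) : K) *
            (algebraMap S K (x l) / algebraMap S K (x k)) =
            (u : K) * (algebraMap S K (x l) / algebraMap S K (x j)) *
              ((w : K) * (algebraMap S K (x j) / algebraMap S K (x k))) := by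
          rw [MulMemClass.coe_mul]
          field_simp
        rwa [e]

/-- Nonzero finitely generated ideals extended to the integral closure are invertible. -/
theorem exists_sum_mul_eq_one_of_field {S K : Type*} [CommRing S] [IsNoetherianRing S]
    [Ring.KrullDimLE 1 S] [Field K] [Algebra S K] {ι : Type*} [Fintype ι] (x : ι → S)
    (hx : ∃ j, algebraMap S K (x j) ≠ 0) :
    ∃ z : ι → K, ∑ j, algebraMap S K (x j) * z j = 1 ∧
      ∀ l j, IsIntegral S (algebraMap S K (x l) * z j) := by
  classical
  -- The values `∑ x_j z_j` over admissible `z` form an ideal. No prime `P` contains it: if `x_j`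
  -- divides every `x_l` up to `u ∉ P`, then `z_j = u / x_j` produces `u`.
  let T : Ideal (integralClosure S K) :=
    { carrier := {d | ∃ z : ι → K, ∑ j, algebraMap S K (x j) * z j = d ∧
        ∀ l j, IsIntegral S (algebraMap S K (x l) * z j)}
      zero_mem' := ⟨0, by simp, fun l j ↦ by simpa using isIntegral_zero⟩
      add_mem' := by
        rintro d e ⟨z, hz, hz'⟩ ⟨w, hw, hw'⟩
        refine ⟨z + w, by simp [mul_add, Finset.sum_add_distrib, hz, hw], fun l j ↦ ?_⟩
        rw [Pi.add_apply, mul_add]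
        exact (hz' l j).add (hw' l j)
      smul_mem' := by
        rintro d e ⟨z, hz, hz'⟩
        refine ⟨fun j ↦ d * z j, ?_, fun l j ↦ ?_⟩
        · rw [smul_eq_mul, MulMemClass.coe_mul, ← hz, Finset.mul_sum]
          exact Finset.sum_congr rfl fun j _ ↦ by ring
        · have := d.2.mul (hz' l j)
          rwa [mul_left_comm] at this }
  suffices hT : T = ⊤ by
    obtain ⟨z, hz, hz'⟩ := (Ideal.eq_top_iff_one T).mp hT
    exact ⟨z, by simpa using hz, hz'⟩
  by_contra hT
  obtain ⟨P, hP, hTP⟩ := Ideal.exists_le_maximal T hT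
  have := hP.isPrime
  obtain ⟨u, j, hu, hj, h⟩ := exists_forall_mul_div_isIntegral P x hx
  refine hu (hTP ⟨Pi.single j (u / algebraMap S K (x j)), ?_, fun l k ↦ ?_⟩)
  · rw [Finset.sum_eq_single j (fun k _ hk ↦ by simp [hk]) (by simp), Pi.single_eq_same]
    field_simp
  · by_cases hk : k = j
    · subst hk
      rw [Pi.single_eq_same]
      convert h l using 1
      ring
    · simpa [hk] using isIntegral_zero

/-! ### The total quotient ring as a product of fields -/

/-- The total quotient ring of a reduced Noetherian ring is Artinian. -/
theorem isArtinianRing_localization_nonZeroDivisors (S : Type*) [CommRing S] [IsNoetherianRing S]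
    [IsReduced S] : IsArtinianRing (Localization S⁰) := by
  have : IsNoetherianRing (Localization S⁰) :=
    IsLocalization.isNoetherianRing S⁰ (Localization S⁰) inferInstance
  -- A contracted prime consists of zero divisors, hence lies in the union of the finitely many
  -- minimal primes, and prime avoidance applies.
  have hmin : ∀ P : Ideal (Localization S⁰), P.IsPrime →
      P.comap (algebraMap S (Localization S⁰)) ∈ minimalPrimes S := by
    intro P hP
    have hp := (IsLocalization.isPrime_iff_isPrime_disjoint S⁰ (Localization S⁰) P).mp hP
    have hsub : ((P.comap (algebraMap S (Localization S⁰)) : Ideal S) : Set S) ⊆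
        ⋃ p ∈ minimalPrimes S, (p : Set S) := by
      intro x hx
      rw [minimalPrimes, Ideal.iUnion_minimalPrimes]
      have hx' : x ∉ S⁰ := fun h ↦ Set.disjoint_left.mp hp.2 h hx
      rw [mem_nonZeroDivisors_iff_right] at hx'
      push Not at hx'
      obtain ⟨y, hy, hy0⟩ := hx'
      have hrad : (⊥ : Ideal S).radical = ⊥ := nilradical_eq_zero S
      refine ⟨y, by rwa [hrad, Ideal.mem_bot], ?_⟩
      rw [hrad, Ideal.mem_bot, mul_comm, hy]
    obtain ⟨p, hpm, hle⟩ := (Ideal.subset_union_prime_finite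
      (minimalPrimes.finite_of_isNoetherianRing S) ⊥ ⊥ fun p hp _ _ ↦ hp.1.1).mp hsub
    have : P.comap (algebraMap S (Localization S⁰)) = p :=
      le_antisymm hle (hpm.2 ⟨hp.1, bot_le⟩ hle)
    exact this ▸ hpm
  rw [isArtinianRing_iff_krullDimLE_zero, Ring.krullDimLE_zero_iff]
  intro P hP
  obtain ⟨Q, hQ, hPQ⟩ := Ideal.exists_le_maximal P hP.ne_top
  have h := hmin Q hQ.isPrime
  have heq : Q.comap (algebraMap S (Localization S⁰)) ≤ P.comap (algebraMap S _) :=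
    h.2 ⟨(hmin P hP).1.1, bot_le⟩ (Ideal.comap_mono hPQ)
  have : P = Q := le_antisymm hPQ <| by
    rw [← IsLocalization.map_under S⁰ _ Q, ← IsLocalization.map_under S⁰ _ P]
    exact Ideal.map_mono heq
  exact this ▸ hQ

/-- Extended ideals are invertible in the integral closure of a reduced one-dimensional Noetherian
ring in its total quotient ring, on the components where they do not vanish. -/
theorem exists_sum_mul_mul_eq_self {S : Type*} [CommRing S] [IsNoetherianRing S]
    [Ring.KrullDimLE 1 S] [IsReduced S] {ι : Type*} [Fintype ι] (x : ι → S) :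
    ∃ z : ι → Localization S⁰,
      (∀ l, (∑ j, algebraMap S (Localization S⁰) (x j) * z j) * algebraMap S _ (x l) =
        algebraMap S _ (x l)) ∧
      ∀ l j, IsIntegral S (algebraMap S (Localization S⁰) (x l) * z j) := by
  classical
  set Q := Localization S⁰ with hQ
  have : IsArtinianRing Q := isArtinianRing_localization_nonZeroDivisors S
  -- The problem is solved in each field factor `Q / P`, with `z = 0` where all `x j` vanish.
  have key : ∀ P : MaximalSpectrum Q, ∃ z : ι → Q,
      (∀ l, Ideal.Quotient.mk P.asIdeal ((∑ j, algebraMap S Q (x j) * z j) * algebraMap S Q (x l)) =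
        Ideal.Quotient.mk P.asIdeal (algebraMap S Q (x l))) ∧
      ∀ l j, IsIntegral S (Ideal.Quotient.mk P.asIdeal (algebraMap S Q (x l) * z j)) := by
    intro P
    let : Field (Q ⧸ P.asIdeal) := Ideal.Quotient.field P.asIdeal
    have hmk : ∀ s : S, algebraMap S (Q ⧸ P.asIdeal) s =
        Ideal.Quotient.mk P.asIdeal (algebraMap S Q s) := fun s ↦ rfl
    by_cases hx : ∃ j, algebraMap S (Q ⧸ P.asIdeal) (x j) ≠ 0
    · obtain ⟨z, hz, hz'⟩ := exists_sum_mul_eq_one_of_field (K := Q ⧸ P.asIdeal) x hx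
      choose w hw using fun j ↦ Ideal.Quotient.mk_surjective (z j)
      refine ⟨w, fun l ↦ ?_, fun l j ↦ ?_⟩
      · rw [map_mul, map_sum]
        simp only [map_mul, hw, ← hmk]
        rw [hz, one_mul]
      · rw [map_mul, hw, ← hmk]
        exact hz' l j
    · push Not at hx
      refine ⟨0, fun l ↦ ?_, fun l j ↦ ?_⟩
      · rw [map_mul, ← hmk, hx, mul_zero]
      · simpa using isIntegral_zero
  choose w hw hw' using key
  let e := IsArtinianRing.equivPi Q
  have he : ∀ (y : Q) (P : MaximalSpectrum Q), e y P = Ideal.Quotient.mk P.asIdeal y :=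
    fun y P ↦ IsArtinianRing.equivPi_apply Q y P
  let z : ι → Q := fun j ↦ e.symm fun P ↦ Ideal.Quotient.mk P.asIdeal (w P j)
  have hz : ∀ j P, Ideal.Quotient.mk P.asIdeal (z j) = Ideal.Quotient.mk P.asIdeal (w P j) := by
    intro j P
    rw [← he]
    simp only [z, AlgEquiv.apply_symm_apply]
  refine ⟨z, fun l ↦ ?_, fun l j ↦ ?_⟩
  · apply e.injective
    funext P
    rw [he, he, ← hw P l]
    simp only [map_mul, map_sum, hz]
    rfl
  · have hint : ∀ P : MaximalSpectrum Q, IsIntegral S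
        (Ideal.Quotient.mk P.asIdeal (algebraMap S Q (x l) * z j)) := fun P ↦ by
      rw [map_mul, hz, ← map_mul]
      exact hw' P l j
    choose q hq hq' using hint
    have := Fintype.ofFinite (MaximalSpectrum Q)
    -- The product of the monic equations of the components vanishes in every component.
    refine ⟨∏ P, q P, Polynomial.monic_prod_of_monic _ _ fun P _ ↦ hq P, ?_⟩
    rw [← Polynomial.aeval_def]
    apply e.injective
    funext P
    rw [he, map_zero, Pi.zero_apply, map_prod, map_prod]
    refine Finset.prod_eq_zero (Finset.mem_univ P) ?_
    have := hq' P
    rw [← Polynomial.aeval_def] at this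
    rw [← this]
    exact (Polynomial.aeval_algHom_apply (Ideal.Quotient.mkₐ S P.asIdeal) _ _).symm

/-! ### Seminormality and conductors -/

/-- The conductor of a seminormal ring in an overring inside the total quotient ring is radical in
the overring. -/
theorem mem_range_of_pow_mul_mem_range {S Q : Type*} [CommRing S] [CommRing Q] [Algebra S Q]
    (hS : ∀ q : Q, q ^ 2 ∈ (algebraMap S Q).range → q ^ 3 ∈ (algebraMap S Q).range →
      q ∈ (algebraMap S Q).range)
    (B : Subalgebra S Q) {x : Q} (N : ℕ)
    (h : ∀ n, N ≤ n → ∀ b ∈ B, x ^ n * b ∈ (algebraMap S Q).range) :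
    x ∈ (algebraMap S Q).range := by
  suffices H : ∀ n, 1 ≤ n → ∀ b ∈ B, x ^ n * b ∈ (algebraMap S Q).range by
    simpa using H 1 le_rfl 1 B.one_mem
  -- Downward induction on the exponent: for `n ≥ 1` both `2n` and `3n` exceed `n`, so the square
  -- and cube of `x ^ n * b` are already in `S`.
  suffices H : ∀ k, ∀ n, N ≤ n + k → 1 ≤ n → ∀ b ∈ B, x ^ n * b ∈ (algebraMap S Q).range from
    fun n hn ↦ H N n (by omega) hn
  intro k
  induction k with
  | zero => exact fun n hn _ ↦ h n (by omega)
  | succ k ih =>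
    intro n hn h1 b hb
    apply hS
    · rw [mul_pow, ← pow_mul]
      exact ih _ (by omega) (by omega) _ (B.pow_mem hb 2)
    · rw [mul_pow, ← pow_mul]
      exact ih _ (by omega) (by omega) _ (B.pow_mem hb 3)

/-- Since `S / tS` has finite length, its submodules `m ^ k (S / tS)` stabilize, and Nakayama's
lemma gives `s ≡ 1` mod `m` killing the stable one. -/
theorem exists_mul_pow_le_span_singleton {S : Type*} [CommRing S] [IsNoetherianRing S]
    [Ring.KrullDimLE 1 S] {t : S} (ht : t ∈ S⁰) (m : Ideal S) [m.IsMaximal] :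
    ∃ s ∉ m, ∃ k, ∀ a ∈ m ^ k, s * a ∈ Ideal.span {t} := by
  have : IsArtinian S (S ⧸ Ideal.span {t}) :=
    (isFiniteLength_iff_isNoetherian_isArtinian.mp
      (Module.length_ne_top_iff.mp (Ring.ord_ne_top ht))).2
  obtain ⟨k, hk⟩ := IsArtinian.monotone_stabilizes
    ⟨fun k ↦ OrderDual.toDual (m ^ k • (⊤ : Submodule S (S ⧸ Ideal.span {t}))),
      fun _ _ h ↦ Submodule.smul_mono_left (Ideal.pow_le_pow_right h)⟩
  have hk' : m ^ k • (⊤ : Submodule S (S ⧸ Ideal.span {t})) = m ^ (k + 1) • ⊤ :=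
    hk (k + 1) (Nat.le_succ k)
  obtain ⟨s, hs, hs'⟩ := Submodule.exists_sub_one_mem_and_smul_eq_zero_of_fg_of_le_smul m
    (m ^ k • (⊤ : Submodule S (S ⧸ Ideal.span {t}))) (IsNoetherian.noetherian _)
    (by rw [← Submodule.mul_smul, ← pow_succ', ← hk'])
  refine ⟨s, fun hsm ↦ ?_, k, fun a ha ↦ ?_⟩
  · refine (Ideal.ne_top_iff_one m).mp (Ideal.IsPrime.ne_top inferInstance) ?_
    simpa using m.sub_mem hsm hs
  · have := hs' (a • Ideal.Quotient.mk _ 1) (Submodule.smul_mem_smul ha trivial)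
    rw [← Ideal.Quotient.eq_zero_iff_mem, ← this, smul_smul, Algebra.smul_def, map_one, mul_one]
    rfl

theorem Subalgebra.mul_mem_mul_smul_toSubmodule {S Q : Type*} [CommRing S] [CommRing Q]
    [Algebra S Q] (B : Subalgebra S Q) {I J : Ideal S} {p q : Q}
    (hp : p ∈ I • Subalgebra.toSubmodule B) (hq : q ∈ J • Subalgebra.toSubmodule B) :
    p * q ∈ (I * J) • Subalgebra.toSubmodule B := by
  induction hp using Submodule.smul_induction_on' with
  | add p _ p' _ ih ih' => rw [add_mul]; exact add_mem ih ih'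
  | smul a ha b hb =>
    induction hq using Submodule.smul_induction_on' with
    | add q _ q' _ ih ih' => rw [mul_add]; exact add_mem ih ih'
    | smul c hc e he =>
      rw [smul_mul_smul_comm]
      exact Submodule.smul_mem_smul (Ideal.mul_mem_mul ha hc) (B.mul_mem hb he)

/-- An element of a finite overring of a seminormal ring `S` that lies in the radical of the
extension of a maximal ideal `m` is in `S`, locally at `m`. -/
theorem exists_mul_mem_range_of_pow_mem_smul {S : Type*} [CommRing S] [IsNoetherianRing S]
    [Ring.KrullDimLE 1 S] {Q : Type*} [CommRing Q] [Algebra S Q] [IsLocalization S⁰ Q]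
    (hS : ∀ q : Q, q ^ 2 ∈ (algebraMap S Q).range → q ^ 3 ∈ (algebraMap S Q).range →
      q ∈ (algebraMap S Q).range)
    (m : Ideal S) [m.IsMaximal] (B : Subalgebra S Q) (hB : (Subalgebra.toSubmodule B).FG)
    {y : Q} (hy : y ∈ B) {d : ℕ} (hyd : y ^ d ∈ m • Subalgebra.toSubmodule B) :
    ∃ s ∉ m, algebraMap S Q s * y ∈ (algebraMap S Q).range := by
  obtain ⟨T, hT⟩ := hB
  obtain ⟨t, ht⟩ := IsLocalization.exist_integer_multiples_of_finset S⁰ T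
  have htB : ∀ b ∈ B, algebraMap S Q t * b ∈ (algebraMap S Q).range := by
    intro b hb
    rw [← Subalgebra.mem_toSubmodule, ← hT] at hb
    induction hb using Submodule.span_induction with
    | mem b hb =>
      obtain ⟨r, hr⟩ := ht b hb
      exact ⟨r, by rw [hr]; simp [Algebra.smul_def]⟩
    | zero => exact ⟨0, by simp⟩
    | add a b _ _ ha hb => rw [mul_add]; exact add_mem ha hb
    | smul a b _ hb =>
      rw [Algebra.smul_def, mul_left_comm]
      exact mul_mem ⟨a, rfl⟩ hb
  obtain ⟨s, hs, k, hk⟩ := exists_mul_pow_le_span_singleton t.2 m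
  -- The exponent `d * k` puts `y ^ n` in `m ^ k B`, and `s m ^ k B ⊆ t B ⊆ S`; the `+ 1` ensures
  -- that `(s y) ^ n` supplies a factor `s`.
  refine ⟨s, hs, mem_range_of_pow_mul_mem_range hS B (d * k + 1) fun n hn b hb ↦ ?_⟩
  have hpow : ∀ i, (y ^ d) ^ i ∈ m ^ i • Subalgebra.toSubmodule B := by
    intro i
    induction i with
    | zero => simp
    | succ i ih =>
      rw [pow_succ, pow_succ]
      exact B.mul_mem_mul_smul_toSubmodule ih hyd
  have hsB : ∀ c ∈ m ^ k • Subalgebra.toSubmodule B,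
      ∀ b ∈ B, algebraMap S Q s * c * b ∈ (algebraMap S Q).range := by
    intro c hc
    induction hc using Submodule.smul_induction_on' with
    | smul a ha c hc =>
      intro b hb
      obtain ⟨r, hr⟩ := Ideal.mem_span_singleton'.mp (hk a ha)
      have : algebraMap S Q s * a • c * b = algebraMap S Q r * (algebraMap S Q t * (c * b)) := by
        rw [Algebra.smul_def, ← mul_assoc, ← map_mul, ← hr, map_mul]
        ring
      rw [this]
      exact mul_mem ⟨r, rfl⟩ (htB _ (B.mul_mem hc hb))
    | add c hc c' hc' ih ih' =>
      intro b hb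
      rw [mul_add, add_mul]
      exact add_mem (ih b hb) (ih' b hb)
  have hfin := hsB _ (hpow k) (y ^ (n - d * k) * b) (B.mul_mem (B.pow_mem hy _) hb)
  have : (algebraMap S Q s * y) ^ n * b = algebraMap S Q (s ^ (n - 1)) *
      (algebraMap S Q s * (y ^ d) ^ k * (y ^ (n - d * k) * b)) := by
    have e1 : (algebraMap S Q s) ^ n = algebraMap S Q s ^ (n - 1) * algebraMap S Q s := by
      rw [← pow_succ, Nat.sub_add_cancel (by omega)]
    have e2 : y ^ n = (y ^ d) ^ k * y ^ (n - d * k) := by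
      rw [← pow_mul, ← pow_add, Nat.add_sub_of_le (by omega)]
    rw [mul_pow, e1, e2, map_pow]
    ring
  rw [this]
  exact mul_mem ⟨_, rfl⟩ hfin

/-! ### Inner integral closure in a seminormal ring -/

/-- If the extension of `J` to a seminormal ring's integral closure `S'` is invertible with inverse
generated by the `z j`, then for `f` in the inner integral closure of `J` the products `z j * f`
are in the radical of `J S'`, which forces `f ∈ J`. -/
theorem mem_of_mem_innerIntegralClosure {S Q : Type*} [CommRing S] [IsNoetherianRing S]
    [Ring.KrullDimLE 1 S] [CommRing Q] [IsReduced Q] [Algebra S Q] [IsLocalization S⁰ Q]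
    (hS : ∀ q : Q, q ^ 2 ∈ (algebraMap S Q).range → q ^ 3 ∈ (algebraMap S Q).range →
      q ∈ (algebraMap S Q).range)
    {J : Ideal S} {n : ℕ} {x : Fin n → S} (hx : Submodule.span S (Set.range x) = J)
    {z : Fin n → Q}
    (hz : ∀ l, (∑ j, algebraMap S Q (x j) * z j) * algebraMap S Q (x l) = algebraMap S Q (x l))
    (hzint : ∀ l j, IsIntegral S (algebraMap S Q (x l) * z j))
    {f : S} (hf' : f ∈ innerIntegralClosure J) : f ∈ J := by
  obtain ⟨d, hd, a, ha, hf⟩ := hf'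
  set A := algebraMap S Q with hA
  have hinj : Function.Injective A := IsLocalization.injective Q le_rfl
  have hxJ : ∀ l, x l ∈ J := fun l ↦ hx ▸ Submodule.subset_span ⟨l, rfl⟩
  have heJ : ∀ g ∈ J, (∑ j, A (x j) * z j) * A g = A g := by
    intro g hg
    rw [← hx] at hg
    induction hg using Submodule.span_induction with
    | mem g hg => obtain ⟨l, rfl⟩ := hg; exact hz l
    | zero => simp
    | add g h _ _ hg hh => rw [map_add, mul_add, hg, hh]
    | smul s g _ hg => rw [smul_eq_mul, map_mul, mul_left_comm, hg]
  -- With `e = ∑ x_j z_j`, which need not be `1`, `f ^ d ∈ J` gives `((1 - e) f) ^ d = 0`, and `Q`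
  -- is reduced.
  have hfe : A f = ∑ j, A (x j) * (z j * A f) := by
    have hfd : f ^ d ∈ J := by
      rw [eq_neg_of_add_eq_zero_left hf]
      exact J.neg_mem (J.sum_mem fun j hj ↦ J.mul_mem_right _ (Ideal.mul_le_left (ha j hj)))
    have h0 : ((1 - ∑ j, A (x j) * z j) * A f) ^ d = 0 := by
      rw [mul_pow, ← map_pow, ← pow_sub_one_mul (by omega : d ≠ 0) (1 - _), mul_assoc, sub_mul, one_mul, heJ _ hfd, sub_self, mul_zero]
    have h1 := eq_zero_of_pow_eq_zero h0
    rw [sub_mul, one_mul, sub_eq_zero, Finset.sum_mul] at h1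
    exact h1.trans (Finset.sum_congr rfl fun j _ ↦ mul_assoc _ _ _)
  -- Of the `i + 1` factors from `J`, `i` absorb `z_j ^ i` and the spare one remains as a
  -- coefficient in `J`.
  have hpow : ∀ B : Subalgebra S Q, (∀ l j, A (x l) * z j ∈ B) → ∀ j i, ∀ g ∈ J * J ^ i,
      z j ^ i * A g ∈ J • Subalgebra.toSubmodule B := by
    intro B hB j
    have hJ1 : ∀ g ∈ J, z j * A g ∈ B := by
      intro g hg
      rw [← hx] at hg
      induction hg using Submodule.span_induction with
      | mem g hg => obtain ⟨l, rfl⟩ := hg; rw [mul_comm]; exact hB l j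
      | zero => simp
      | add g h _ _ hg hh => rw [map_add, mul_add]; exact add_mem hg hh
      | smul s g _ hg =>
        rw [smul_eq_mul, map_mul, mul_left_comm]
        exact mul_mem (B.algebraMap_mem s) hg
    have hJi : ∀ i, ∀ g ∈ J ^ i, z j ^ i * A g ∈ B := by
      intro i
      induction i with
      | zero => intro g _; rw [pow_zero, one_mul]; exact B.algebraMap_mem g
      | succ i ih =>
        intro g hg
        rw [pow_succ] at hg
        induction hg using Submodule.mul_induction_on' with
        | mem_mul_mem r hr s hs =>
          rw [map_mul, pow_succ, mul_mul_mul_comm]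
          exact mul_mem (ih r hr) (hJ1 s hs)
        | add r _ s _ hr hs => rw [map_add, mul_add]; exact add_mem hr hs
    intro i g hg
    induction hg using Submodule.mul_induction_on' with
    | mem_mul_mem r hr s hs =>
      have := Submodule.smul_mem_smul hr (N := Subalgebra.toSubmodule B) (hJi i s hs)
      have e : z j ^ i * A (r * s) = r • (z j ^ i * A s) := by
        rw [Algebra.smul_def, map_mul, mul_left_comm]
      rwa [e]
    | add r _ s _ hr hs => rw [map_add, mul_add]; exact add_mem hr hs
  have heq : ∀ j, (z j * A f) ^ d +
      ∑ i ∈ Finset.Icc 1 d, (z j ^ i * A (a i)) * (z j * A f) ^ (d - i) = 0 := by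
    intro j
    have h : z j ^ d * A (f ^ d + ∑ i ∈ Finset.Icc 1 d, a i * f ^ (d - i)) = 0 := by
      rw [hf, map_zero, mul_zero]
    rw [← h, map_add, mul_add, map_pow, mul_pow, map_sum, Finset.mul_sum]
    congr 1
    refine Finset.sum_congr rfl fun i hi ↦ ?_
    have hzd : z j ^ d = z j ^ i * z j ^ (d - i) := by
      rw [← pow_add, Nat.add_sub_of_le (Finset.mem_Icc.mp hi).2]
    rw [map_mul, map_pow, mul_pow, hzd]
    ring
  have hyint : ∀ j, IsIntegral S (z j * A f) := by
    intro j
    have hc : ∀ i ∈ Finset.Icc 1 d, IsIntegral S (z j ^ i * A (a i)) := fun i hi ↦ by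
      have := hpow (integralClosure S Q) hzint j i (a i) (ha i hi)
      exact Submodule.smul_le_right this
    let c : ℕ → integralClosure S Q := fun i ↦
      if hi : i ∈ Finset.Icc 1 d then ⟨_, hc i hi⟩ else 0
    refine isIntegral_trans (A := integralClosure S Q) _ ⟨Polynomial.X ^ d +
      ∑ i ∈ Finset.Icc 1 d, Polynomial.C (c i) * Polynomial.X ^ (d - i),
      Polynomial.monic_X_pow_add ?_, ?_⟩
    · rw [← Polynomial.mem_degreeLT]
      refine sum_mem fun i hi ↦ Polynomial.mem_degreeLT.mpr ?_
      refine (Polynomial.degree_C_mul_X_pow_le _ _).trans_lt ?_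
      have := Finset.mem_Icc.mp hi
      exact_mod_cast (by omega : d - i < d)
    · rw [← Polynomial.aeval_def, ← heq j]
      simp only [map_add, map_pow, Polynomial.aeval_X, map_sum, map_mul, Polynomial.aeval_C]
      congr 1
      refine Finset.sum_congr rfl fun i hi ↦ ?_
      simp only [c, dif_pos hi]
      rfl
  -- `S'` need not be finite over `S`, so the argument moves to a finite subalgebra containing all
  -- elements in play.
  let G : Set Q := Set.range (fun p : Fin n × Fin n ↦ A (x p.1) * z p.2) ∪
    Set.range fun j ↦ z j * A f
  let B := Algebra.adjoin S G
  have hBfg : (Subalgebra.toSubmodule B).FG := by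
    refine fg_adjoin_of_finite ((Set.finite_range _).union (Set.finite_range _)) ?_
    rintro _ (⟨p, rfl⟩ | ⟨j, rfl⟩)
    exacts [hzint _ _, hyint j]
  have hyB : ∀ j, z j * A f ∈ B := fun j ↦ Algebra.subset_adjoin (Or.inr ⟨j, rfl⟩)
  have hyd : ∀ j, (z j * A f) ^ d ∈ J • Subalgebra.toSubmodule B := by
    intro j
    rw [eq_neg_of_add_eq_zero_left (heq j)]
    refine neg_mem (sum_mem fun i hi ↦ ?_)
    have h1 := hpow B (fun l j ↦ Algebra.subset_adjoin (Or.inl ⟨(l, j), rfl⟩)) j i (a i) (ha i hi)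
    have h2 : (z j * A f) ^ (d - i) ∈ (⊤ : Ideal S) • Subalgebra.toSubmodule B := by
      rw [Submodule.top_smul]
      exact B.pow_mem (hyB j) (d - i)
    simpa only [Ideal.mul_top] using B.mul_mem_mul_smul_toSubmodule h1 h2
  -- `T` is the colon ideal `(J : f)`. A maximal ideal above it contains `J`, so `J B ⊆ m B` and
  -- each `y_j` is in `S` up to a multiplier outside `m`.
  let T : Ideal S := Submodule.comap (LinearMap.toSpanSingleton S S f) J
  have hT : ∀ s, s ∈ T ↔ s * f ∈ J := fun s ↦ Iff.rfl
  suffices T = ⊤ by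
    have := (Ideal.eq_top_iff_one T).mp this
    rwa [hT, one_mul] at this
  by_contra hne
  obtain ⟨m, hm, hTm⟩ := Ideal.exists_le_maximal T hne
  have hJm : J ≤ m := fun g hg ↦ hTm ((hT g).mpr (J.mul_mem_right f hg))
  choose s hs hs' using fun j ↦ exists_mul_mem_range_of_pow_mem_smul hS m B hBfg (hyB j)
    (Submodule.smul_mono_left hJm (hyd j))
  have hprod : ∏ j, s j ∉ m := fun h ↦ by
    obtain ⟨j, -, hj⟩ := (Ideal.IsPrime.prod_mem_iff (hp := hm.isPrime)).mp h
    exact hs j hj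
  refine hprod (hTm ((hT _).mpr ?_))
  have hr : ∀ j, ∃ r, A r = A (∏ j, s j) * (z j * A f) := fun j ↦ by
    obtain ⟨r, hr⟩ := hs' j
    refine ⟨r * ∏ i ∈ Finset.univ.erase j, s i, ?_⟩
    rw [map_mul, hr, ← Finset.mul_prod_erase _ _ (Finset.mem_univ j), map_mul]
    ring
  choose r hr using hr
  have : (∏ j, s j) * f = ∑ j, x j * r j := by
    apply hinj
    rw [map_mul, hfe, Finset.mul_sum, map_sum]
    refine Finset.sum_congr rfl fun j _ ↦ ?_
    rw [map_mul, hr]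
    ring
  rw [this]
  exact J.sum_mem fun j _ ↦ J.mul_mem_right _ (hxJ j)

/-- In a one-dimensional seminormal Noetherian ring, the inner integral closure of an ideal is the
ideal itself. -/
theorem innerIntegralClosure_subset_of_isSeminormalRing {S : Type*} [CommRing S]
    [IsNoetherianRing S] [Ring.KrullDimLE 1 S] (hS : IsSeminormalRing S) (J : Ideal S) :
    innerIntegralClosure J ⊆ (J : Set S) := by
  intro f hf
  have := hS.1
  obtain ⟨n, x, hx⟩ := Submodule.fg_iff_exists_fin_generating_family.mp
    (IsNoetherian.noetherian J)
  obtain ⟨z, hz, hzint⟩ := exists_sum_mul_mul_eq_self x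
  exact mem_of_mem_innerIntegralClosure hS.2 hx hz hzint hf

/-! ### Passage to the axes closure -/

/-- The inner integral closure is persistent under ring homomorphisms. -/
theorem map_mem_innerIntegralClosure {R S : Type*} [CommRing R] [CommRing S] (φ : R →+* S)
    {I : Ideal R} {f : R} (hf : f ∈ innerIntegralClosure I) :
    φ f ∈ innerIntegralClosure (I.map φ) := by
  obtain ⟨d, hd, a, ha, h⟩ := hf
  refine ⟨d, hd, fun j ↦ φ (a j), fun j hj ↦ ?_, ?_⟩
  · rw [← Ideal.map_pow, ← Ideal.map_mul]
    exact Ideal.mem_map_of_mem φ (ha j hj)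
  · simpa using congrArg φ h

/-- Persistence moves `f` into the inner closure of `I S`, which is contained in `I S`; all three
classes of test rings satisfy `hP`. -/
theorem mem_closureVia_of_mem_innerIntegralClosure (P : ∀ (S : Type v) [CommRing S], Prop)
    (hP : ∀ (S : Type v) [CommRing S], P S →
      IsNoetherianRing S ∧ ringKrullDim S = 1 ∧ IsSeminormalRing S)
    {R : Type u} [CommRing R] {I : Ideal R} {f : R} (hf : f ∈ innerIntegralClosure I) :
    f ∈ closureVia.{u, v} P I := by
  rw [mem_closureVia]
  intro S _ hS φ
  obtain ⟨_, hdim, hsn⟩ := hP S hS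
  have : Ring.KrullDimLE 1 S := (Order.krullDimLE_iff 1 _).mpr (by
    rw [← ringKrullDim, hdim, Nat.cast_one])
  exact innerIntegralClosure_subset_of_isSeminormalRing hsn _ (map_mem_innerIntegralClosure φ hf)

theorem mainTheorem5 {R : Type u} [CommRing R] (hR : IsExcellentRing R) (I : Ideal R) :
    innerIntegralClosure I ⊆ (axesClosure.{u, v} I : Set R) := by
  intro f hf
  refine ⟨⟨?_, ?_⟩, ?_⟩
  · exact mem_closureVia_of_mem_innerIntegralClosure _
      (fun S _ h ↦ ⟨h.1.isNoetherianRing, h.2⟩) hf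
  · exact mem_closureVia_of_mem_innerIntegralClosure _
      (fun S _ h ↦ ⟨h.2.1.isNoetherianRing, h.2.2⟩) hf
  · exact mem_closureVia_of_mem_innerIntegralClosure _
      (fun S _ h ↦ ⟨h.1, h.2.2⟩) hf
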